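/- Let $k$ be a field (for instance $k=\mathbb{C}$) and let $q\in k$ with $q\neq 0,1,-1$. Let $v\mathfrak{sl}_q(2)$ be the unital associative $k$-algebra generated by $E_v,F_v,K_v,\overline K_v$ subject to the relations (with $J_v=K_v\overline K_v$) $$K_v\overline K_v=\overline K_vK_v,\qquad K_v\overline K_vK_v=K_v,\qquad \overline K_vK_v\overline K_v=\overline K_v,$$ $$K_vE_v\overline K_v=q^2E_v,\qquad K_vF_v\overline K_v=q^{-2}F_v,\qquad E_vJ_vF_v-F_vJ_vE_v=\frac{K_v-\overline K_v}{q-q^{-1}}.$$ It is a bialgebra over $k$ with the comultiplication $\Delta_v$ and the counit $\varepsilon_v$, the algebra morphisms determined by $$\Delta_v(E_v)=J_v\otimes J_vE_vJ_v+J_vE_vJ_v\otimes K_v,\qquad \Delta_v(F_v)=J_vF_vJ_v\otimes J_v+\overline K_v\otimes J_vF_vJ_v,$$ $$\Delta_v(K_v)=K_v\otimes K_v,\qquad \Delta_v(\overline K_v)=\overline K_v\otimes\overline K_v,$$ $$\varepsilon_v(E_v)=\varepsilon_v(F_v)=0,\qquad \varepsilon_v(K_v)=\varepsilon_v(\overline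 K_v)=1.$$ Let $G(v\mathfrak{sl}_q(2))$ be the set of all group-like elements, i.e. of all $x$ with $\Delta_v(x)=x\otimes x$ and $\varepsilon_v(x)=1$ (equivalently, $\Delta_v(x)=x\otimes x$ and $x\neq 0$). Then $$G(v\mathfrak{sl}_q(2))=\{K_v^i\,\overline K_v^j : i,j\in\mathbb{Z}_{\ge 0}\},$$ and $G(v\mathfrak{sl}_q(2))$ is a regular monoid under the multiplication of $v\mathfrak{sl}_q(2)$: it contains $1$, is closed under multiplication, and for every $x\in G(v\mathfrak{sl}_q(2))$ there is $y\in G(v\mathfrak{sl}_q(2))$ with $xyx=x$. -/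

import Mathlib

open scoped TensorProduct

noncomputable section

/-- The four generators `E_v`, `F_v`, `K_v`, `K̄_v`. -/
inductive VSlGen : Type
  | E
  | F
  | K
  | Kbar

namespace VSl

/-- The defining relations of `v𝔰𝔩_q(2)`, as equations in the free algebra on `E, F, K, K̄`;
the product `K * K̄` inside the last relation is `J`. -/
inductive Rel {k : Type*} [Field k] (q : kˣ) :
    FreeAlgebra k VSlGen → FreeAlgebra k VSlGen → Prop
  | comm : Rel q
      (FreeAlgebra.ι k VSlGen.K * FreeAlgebra.ι k VSlGen.Kbar)
      (FreeAlgebra.ι k VSlGen.Kbar * FreeAlgebra.ι k VSlGen.K)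
  | reg : Rel q
      (FreeAlgebra.ι k VSlGen.K * FreeAlgebra.ι k VSlGen.Kbar * FreeAlgebra.ι k VSlGen.K)
      (FreeAlgebra.ι k VSlGen.K)
  | regBar : Rel q
      (FreeAlgebra.ι k VSlGen.Kbar * FreeAlgebra.ι k VSlGen.K * FreeAlgebra.ι k VSlGen.Kbar)
      (FreeAlgebra.ι k VSlGen.Kbar)
  | conjE : Rel q
      (FreeAlgebra.ι k VSlGen.K * FreeAlgebra.ι k VSlGen.E * FreeAlgebra.ι k VSlGen.Kbar)
      ((q : k) ^ 2 • FreeAlgebra.ι k VSlGen.E)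
  | conjF : Rel q
      (FreeAlgebra.ι k VSlGen.K * FreeAlgebra.ι k VSlGen.F * FreeAlgebra.ι k VSlGen.Kbar)
      (((q : k)⁻¹) ^ 2 • FreeAlgebra.ι k VSlGen.F)
  | bracket : Rel q
      (FreeAlgebra.ι k VSlGen.E * (FreeAlgebra.ι k VSlGen.K * FreeAlgebra.ι k VSlGen.Kbar)
          * FreeAlgebra.ι k VSlGen.F
        - FreeAlgebra.ι k VSlGen.F * (FreeAlgebra.ι k VSlGen.K * FreeAlgebra.ι k VSlGen.Kbar)
          * FreeAlgebra.ι k VSlGen.E)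
      (((q : k) - (q : k)⁻¹)⁻¹ • (FreeAlgebra.ι k VSlGen.K - FreeAlgebra.ι k VSlGen.Kbar))

end VSl

/-- The `J`-weak quantum algebra `v𝔰𝔩_q(2)` over the field `k`: the unital associative algebra
with generators `E, F, K, K̄` and the relations `VSl.Rel q`. -/
def VSl {k : Type*} [Field k] (q : kˣ) : Type _ := RingQuot (VSl.Rel q)

namespace VSl

variable {k : Type*} [Field k] (q : kˣ)

instance : Ring (VSl q) := inferInstanceAs (Ring (RingQuot (VSl.Rel q)))

instance : Algebra k (VSl q) := inferInstanceAs (Algebra k (RingQuot (VSl.Rel q)))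

/-- The quotient map from the free algebra. -/
def mk : FreeAlgebra k VSlGen →ₐ[k] VSl q := RingQuot.mkAlgHom k (VSl.Rel q)

/-- The class of a generator. -/
def gen (g : VSlGen) : VSl q := mk q (FreeAlgebra.ι k g)

/-- The generator `E_v`. -/
def E : VSl q := gen q VSlGen.E

/-- The generator `F_v`. -/
def F : VSl q := gen q VSlGen.F

/-- The generator `K_v`. -/
def K : VSl q := gen q VSlGen.K

/-- The generator `K̄_v`. -/
def Kbar : VSl q := gen q VSlGen.Kbar

/-- The idempotent `J_v = K_v K̄_v`. -/
def J : VSl q := K q * Kbar q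

variable {q} in
theorem mk_rel {x y : FreeAlgebra k VSlGen} (h : Rel q x y) : mk q x = mk q y :=
  RingQuot.mkAlgHom_rel k h

theorem K_mul_Kbar : K q * Kbar q = J q := rfl

theorem Kbar_mul_K : Kbar q * K q = J q := by
  have h := mk_rel (Rel.comm (q := q))
  simp only [map_mul] at h
  exact h.symm

theorem J_mul_K : J q * K q = K q := by
  have h := mk_rel (Rel.reg (q := q))
  simp only [map_mul] at h
  exact h

theorem J_mul_Kbar : J q * Kbar q = Kbar q := by
  rw [← Kbar_mul_K]
  have h := mk_rel (Rel.regBar (q := q))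
  simp only [map_mul] at h
  exact h

theorem K_mul_J : K q * J q = K q := by
  rw [← Kbar_mul_K, ← mul_assoc, K_mul_Kbar, J_mul_K]

theorem Kbar_mul_J : Kbar q * J q = Kbar q := by
  rw [← K_mul_Kbar, ← mul_assoc, Kbar_mul_K, J_mul_Kbar]

theorem J_mul_J : J q * J q = J q := by
  conv_lhs => rw [← K_mul_Kbar q, mul_assoc, K_mul_Kbar, Kbar_mul_J]
  rfl

theorem K_E_Kbar : K q * E q * Kbar q = (q : k) ^ 2 • E q := by
  have h := mk_rel (Rel.conjE (q := q))
  simp only [map_mul, map_smul] at h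
  exact h

theorem K_F_Kbar : K q * F q * Kbar q = ((q : k)⁻¹) ^ 2 • F q := by
  have h := mk_rel (Rel.conjF (q := q))
  simp only [map_mul, map_smul] at h
  exact h

theorem E_J_F : E q * J q * F q - F q * J q * E q
    = ((q : k) - (q : k)⁻¹)⁻¹ • (K q - Kbar q) := by
  have h := mk_rel (Rel.bracket (q := q))
  simp only [map_mul, map_smul, map_sub] at h
  exact h

theorem eq_smul_of_conj {c : k} (hc : c ≠ 0) {x : VSl q} (h : K q * x * Kbar q = c • x) :
    J q * x = x ∧ x * J q = x := by
  have hx : x = c⁻¹ • (K q * x * Kbar q) := by rw [h, smul_smul, inv_mul_cancel₀ hc, one_smul]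
  constructor
  · conv_lhs => rw [hx]
    rw [mul_smul_comm, ← mul_assoc, ← mul_assoc, J_mul_K, ← hx]
  · conv_lhs => rw [hx]
    rw [smul_mul_assoc, mul_assoc, Kbar_mul_J, ← hx]

theorem J_mul_E : J q * E q = E q :=
  (eq_smul_of_conj q (pow_ne_zero 2 q.ne_zero) (K_E_Kbar q)).1

theorem E_mul_J : E q * J q = E q :=
  (eq_smul_of_conj q (pow_ne_zero 2 q.ne_zero) (K_E_Kbar q)).2

theorem J_mul_F : J q * F q = F q :=
  (eq_smul_of_conj q (pow_ne_zero 2 (inv_ne_zero q.ne_zero)) (K_F_Kbar q)).1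

theorem F_mul_J : F q * J q = F q :=
  (eq_smul_of_conj q (pow_ne_zero 2 (inv_ne_zero q.ne_zero)) (K_F_Kbar q)).2

theorem K_mul_E : K q * E q = (q : k) ^ 2 • (E q * K q) := by
  rw [← smul_mul_assoc, ← K_E_Kbar, mul_assoc, Kbar_mul_K, mul_assoc, E_mul_J]

theorem K_mul_F : K q * F q = ((q : k)⁻¹) ^ 2 • (F q * K q) := by
  rw [← smul_mul_assoc, ← K_F_Kbar, mul_assoc, Kbar_mul_K, mul_assoc, F_mul_J]

theorem E_mul_Kbar : E q * Kbar q = (q : k) ^ 2 • (Kbar q * E q) := by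
  rw [← mul_smul_comm, ← K_E_Kbar, ← mul_assoc, ← mul_assoc, Kbar_mul_K, J_mul_E]

theorem F_mul_Kbar : F q * Kbar q = ((q : k)⁻¹) ^ 2 • (Kbar q * F q) := by
  rw [← mul_smul_comm, ← K_F_Kbar, ← mul_assoc, ← mul_assoc, Kbar_mul_K, J_mul_F]

/-- The algebra morphism out of `v𝔰𝔩_q(2)` with prescribed images of the generators that satisfy
the defining relations. -/
def lift {B : Type*} [Ring B] [Algebra k B] (φ : VSlGen → B)
    (hφ : ∀ ⦃x y⦄, Rel q x y → FreeAlgebra.lift k φ x = FreeAlgebra.lift k φ y) :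
    VSl q →ₐ[k] B :=
  RingQuot.liftAlgHom k ⟨FreeAlgebra.lift k φ, hφ⟩

theorem lift_gen {B : Type*} [Ring B] [Algebra k B] (φ : VSlGen → B)
    (hφ : ∀ ⦃x y⦄, Rel q x y → FreeAlgebra.lift k φ x = FreeAlgebra.lift k φ y) (g : VSlGen) :
    lift q φ hφ (gen q g) = φ g :=
  (RingQuot.liftAlgHom_mkAlgHom_apply k _ _ _).trans (FreeAlgebra.lift_ι_apply _ _)

variable {q} in
theorem algHom_ext {B : Type*} [Semiring B] [Algebra k B] {φ ψ : VSl q →ₐ[k] B}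
    (hE : φ (E q) = ψ (E q)) (hF : φ (F q) = ψ (F q))
    (hK : φ (K q) = ψ (K q)) (hKbar : φ (Kbar q) = ψ (Kbar q)) : φ = ψ := by
  have h : φ.comp (mk q) = ψ.comp (mk q) := by
    apply FreeAlgebra.hom_ext
    funext g
    cases g
    exacts [hE, hF, hK, hKbar]
  exact RingQuot.ringQuot_ext' k φ ψ h

/-- The values of the comultiplication `Δ_v` on the generators. -/
def comulGen : VSlGen → VSl q ⊗[k] VSl q
  | .E => J q ⊗ₜ[k] (J q * E q * J q) + (J q * E q * J q) ⊗ₜ[k] K q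
  | .F => (J q * F q * J q) ⊗ₜ[k] J q + Kbar q ⊗ₜ[k] (J q * F q * J q)
  | .K => K q ⊗ₜ[k] K q
  | .Kbar => Kbar q ⊗ₜ[k] Kbar q

theorem comulGen_rel ⦃x y : FreeAlgebra k VSlGen⦄ (h : Rel q x y) :
    FreeAlgebra.lift k (comulGen q) x = FreeAlgebra.lift k (comulGen q) y := by
  cases h <;> simp only [map_mul, map_smul, map_sub, FreeAlgebra.lift_ι_apply, comulGen]
  case comm => simp [Algebra.TensorProduct.tmul_mul_tmul, K_mul_Kbar, Kbar_mul_K]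
  case reg => simp [Algebra.TensorProduct.tmul_mul_tmul, K_mul_Kbar, J_mul_K]
  case regBar => simp [Algebra.TensorProduct.tmul_mul_tmul, Kbar_mul_K, J_mul_Kbar]
  case conjE =>
    simp only [J_mul_E, E_mul_J, mul_add, add_mul, Algebra.TensorProduct.tmul_mul_tmul,
      K_E_Kbar, K_mul_J, K_mul_Kbar, TensorProduct.tmul_smul,
      TensorProduct.smul_tmul', smul_add]
    rw [mul_assoc (K q) (K q), K_mul_Kbar, K_mul_J]
  case conjF =>
    simp only [J_mul_F, F_mul_J, mul_add, add_mul, Algebra.TensorProduct.tmul_mul_tmul,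
      K_F_Kbar, K_mul_J, K_mul_Kbar, J_mul_Kbar, TensorProduct.tmul_smul,
      TensorProduct.smul_tmul', smul_add]
  case bracket =>
    have hc : (q : k) ^ 2 * ((q : k)⁻¹) ^ 2 = 1 := by
      rw [← mul_pow, mul_inv_cancel₀ q.ne_zero, one_pow]
    have hEF := E_J_F q
    rw [E_mul_J, F_mul_J] at hEF
    have h1 := congrArg (fun z => z ⊗ₜ[k] K q) hEF
    have h2 := congrArg (fun z => Kbar q ⊗ₜ[k] z) hEF
    simp only [TensorProduct.sub_tmul, TensorProduct.tmul_sub, TensorProduct.tmul_smul,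
      ← TensorProduct.smul_tmul', smul_sub] at h1 h2
    simp only [J_mul_E, E_mul_J, J_mul_F, F_mul_J, mul_add, add_mul,
      Algebra.TensorProduct.tmul_mul_tmul, K_mul_Kbar, J_mul_J, K_mul_J, Kbar_mul_J, J_mul_K,
      J_mul_Kbar, E_mul_Kbar, K_mul_F, TensorProduct.tmul_smul, ← TensorProduct.smul_tmul',
      smul_smul, hc, mul_comm (((q : k)⁻¹) ^ 2), one_smul, smul_sub]
    linear_combination (norm := module) h1 + h2

/-- The comultiplication `Δ_v`, the algebra morphism with
`Δ_v(E) = J ⊗ J E J + J E J ⊗ K`, `Δ_v(F) = J F J ⊗ J + K̄ ⊗ J F J`,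
`Δ_v(K) = K ⊗ K`, `Δ_v(K̄) = K̄ ⊗ K̄`. -/
def comulHom : VSl q →ₐ[k] VSl q ⊗[k] VSl q := lift q (comulGen q) (comulGen_rel q)

/-- The values of the counit `ε_v` on the generators. -/
def counitGen : VSlGen → k
  | .E => 0
  | .F => 0
  | .K => 1
  | .Kbar => 1

theorem counitGen_rel ⦃x y : FreeAlgebra k VSlGen⦄ (h : Rel q x y) :
    FreeAlgebra.lift k (counitGen (k := k)) x = FreeAlgebra.lift k (counitGen (k := k)) y := by
  cases h <;> simp [counitGen]

/-- The counit `ε_v`, the algebra morphism with `ε_v(E) = ε_v(F) = 0`, `ε_v(K) = ε_v(K̄) = 1`. -/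
def counitHom : VSl q →ₐ[k] k := lift q counitGen (counitGen_rel q)

theorem comulHom_E : comulHom q (E q) = J q ⊗ₜ[k] E q + E q ⊗ₜ[k] K q := by
  refine (lift_gen q _ (comulGen_rel q) .E).trans ?_
  rw [comulGen, J_mul_E, E_mul_J]

theorem comulHom_F : comulHom q (F q) = F q ⊗ₜ[k] J q + Kbar q ⊗ₜ[k] F q := by
  refine (lift_gen q _ (comulGen_rel q) .F).trans ?_
  rw [comulGen, J_mul_F, F_mul_J]

theorem comulHom_K : comulHom q (K q) = K q ⊗ₜ[k] K q := lift_gen q _ (comulGen_rel q) .K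

theorem comulHom_Kbar : comulHom q (Kbar q) = Kbar q ⊗ₜ[k] Kbar q :=
  lift_gen q _ (comulGen_rel q) .Kbar

theorem counitHom_E : counitHom q (E q) = 0 := lift_gen q _ (counitGen_rel q) .E
theorem counitHom_F : counitHom q (F q) = 0 := lift_gen q _ (counitGen_rel q) .F
theorem counitHom_K : counitHom q (K q) = 1 := lift_gen q _ (counitGen_rel q) .K
theorem counitHom_Kbar : counitHom q (Kbar q) = 1 := lift_gen q _ (counitGen_rel q) .Kbar

theorem comulHom_J : comulHom q (J q) = J q ⊗ₜ[k] J q := by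
  rw [J, map_mul, comulHom_K, comulHom_Kbar, Algebra.TensorProduct.tmul_mul_tmul]

theorem counitHom_J : counitHom q (J q) = 1 := by
  rw [J, map_mul, counitHom_K, counitHom_Kbar, mul_one]

/-- The bialgebra structure of `v𝔰𝔩_q(2)` given by `Δ_v` and `ε_v`. -/
instance : Bialgebra k (VSl q) :=
  Bialgebra.ofAlgHom (comulHom q) (counitHom q)
    (by
      apply algHom_ext <;>
        simp [comulHom_E, comulHom_F, comulHom_K, comulHom_Kbar, comulHom_J,
          TensorProduct.add_tmul, TensorProduct.tmul_add, add_assoc])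
    (by
      apply algHom_ext <;>
        simp [comulHom_E, comulHom_F, comulHom_K, comulHom_Kbar,
          counitHom_E, counitHom_F, counitHom_K, counitHom_Kbar, counitHom_J])
    (by
      apply algHom_ext <;>
        simp [comulHom_E, comulHom_F, comulHom_K, comulHom_Kbar,
          counitHom_E, counitHom_F, counitHom_K, counitHom_Kbar, counitHom_J])

end VSl

/-- A monoid is regular if every element `x` has some `y` with `x y x = x`. -/
def IsRegularMonoid (M : Type*) [Monoid M] : Prop :=
  ∀ x : M, ∃ y : M, x * y * x = x

end

/-! Give `E` and `F` degree 1 and `K`, `Kbar` degree 0, and filter the algebra by word degree. On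
generators, hence on all words, the comultiplication respects the induced filtration of the tensor
square. If a group-like `x` had least degree `m + 1`, a functional `f` vanishing in degree at most
`m` with `f x ≠ 0` would make `f ⊗ f` vanish on degree `m + 1` of the tensor square, yet send `x ⊗
x` to `f x ^ 2 ≠ 0`. So `x` has degree 0 (`IsGroupLikeElem.mem_wordFiltration_zero`).

Degree 0 is spanned by the group-likes `K ^ i * Kbar ^ j`. Distinct group-likes are linearly
independent over a field, so `x` is one of these (`IsGroupLikeElem.mem_of_mem_span`). No basis of
the algebra is needed. Regularity follows because `J` is a two-sided unit for `K` and `Kbar`. -/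

section WordFiltration

variable {k A ι : Type*} [Field k] [Semiring A] (g : ι → A) (d : ι → ℕ)

variable (k) in
/-- The span of the words of degree at most `n` in the elements `g i`, where `g i` has
degree `d i`. -/
def wordFiltration [Algebra k A] (n : ℕ) : Submodule k A :=
  Submodule.span k {x | ∃ w : List ι, (w.map d).sum ≤ n ∧ x = (w.map g).prod}

variable (k) in
/-- The filtration of `A ⊗ A` induced by `wordFiltration`. -/
def tensorWordFiltration [Algebra k A] (n : ℕ) : Submodule k (A ⊗[k] A) :=
  Submodule.span k {z | ∃ i j : ℕ, i + j ≤ n ∧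
    ∃ a ∈ wordFiltration k g d i, ∃ b ∈ wordFiltration k g d j, z = a ⊗ₜ[k] b}

section Algebra

variable [Algebra k A]

theorem wordFiltration_mono {m n : ℕ} (h : m ≤ n) :
    wordFiltration k g d m ≤ wordFiltration k g d n :=
  Submodule.span_mono fun _ ⟨w, hw, hx⟩ => ⟨w, hw.trans h, hx⟩

theorem one_mem_wordFiltration (n : ℕ) : (1 : A) ∈ wordFiltration k g d n :=
  Submodule.subset_span ⟨[], by simp, by simp⟩

theorem gen_mem_wordFiltration (i : ι) : g i ∈ wordFiltration k g d (d i) :=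
  Submodule.subset_span ⟨[i], by simp, by simp⟩

theorem mul_mem_wordFiltration {m n : ℕ} {x y : A} (hx : x ∈ wordFiltration k g d m)
    (hy : y ∈ wordFiltration k g d n) : x * y ∈ wordFiltration k g d (m + n) := by
  refine Submodule.mul_le.mp ?_ x hx y hy
  rw [wordFiltration, wordFiltration, Submodule.span_mul_span, Submodule.span_le]
  rintro _ ⟨_, ⟨v, hv, rfl⟩, _, ⟨w, hw, rfl⟩, rfl⟩
  exact Submodule.subset_span ⟨v ++ w, by simpa using add_le_add hv hw, by simp⟩

theorem tmul_mem_tensorWordFiltration {i j n : ℕ} (h : i + j ≤ n) {a b : A}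
    (ha : a ∈ wordFiltration k g d i) (hb : b ∈ wordFiltration k g d j) :
    a ⊗ₜ[k] b ∈ tensorWordFiltration k g d n :=
  Submodule.subset_span ⟨i, j, h, a, ha, b, hb, rfl⟩

theorem tensorWordFiltration_mono {m n : ℕ} (h : m ≤ n) :
    tensorWordFiltration k g d m ≤ tensorWordFiltration k g d n :=
  Submodule.span_mono fun _ ⟨i, j, hij, hx⟩ => ⟨i, j, hij.trans h, hx⟩

theorem mul_mem_tensorWordFiltration {m n : ℕ} {x y : A ⊗[k] A}
    (hx : x ∈ tensorWordFiltration k g d m) (hy : y ∈ tensorWordFiltration k g d n) :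
    x * y ∈ tensorWordFiltration k g d (m + n) := by
  refine Submodule.mul_le.mp ?_ x hx y hy
  conv_lhs => rw [tensorWordFiltration, tensorWordFiltration, Submodule.span_mul_span]
  rw [Submodule.span_le]
  rintro _ ⟨_, ⟨i, j, hij, a, ha, b, hb, rfl⟩, _, ⟨i', j', hij', a', ha', b', hb', rfl⟩, rfl⟩
  simp only [Algebra.TensorProduct.tmul_mul_tmul]
  exact tmul_mem_tensorWordFiltration g d (by omega) (mul_mem_wordFiltration g d ha ha')
    (mul_mem_wordFiltration g d hb hb')

/-- The filtration is exhaustive on the subalgebra generated by the family. -/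
theorem mem_wordFiltration_of_mem_adjoin {x : A} (hx : x ∈ Algebra.adjoin k (Set.range g)) :
    ∃ n, x ∈ wordFiltration k g d n := by
  induction hx using Algebra.adjoin_induction with
  | mem x hx =>
    obtain ⟨i, rfl⟩ := hx
    exact ⟨d i, gen_mem_wordFiltration g d i⟩
  | algebraMap r =>
    refine ⟨0, ?_⟩
    rw [Algebra.algebraMap_eq_smul_one]
    exact Submodule.smul_mem _ _ (one_mem_wordFiltration g d 0)
  | add x y _ _ hx hy =>
    obtain ⟨m, hm⟩ := hx
    obtain ⟨n, hn⟩ := hy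
    exact ⟨max m n, add_mem (wordFiltration_mono g d (le_max_left m n) hm)
      (wordFiltration_mono g d (le_max_right m n) hn)⟩
  | mul x y _ _ hx hy =>
    obtain ⟨m, hm⟩ := hx
    obtain ⟨n, hn⟩ := hy
    exact ⟨m + n, mul_mem_wordFiltration g d hm hn⟩

end Algebra

/-! ### Group-like elements of a filtered bialgebra -/

section Bialgebra

variable [Bialgebra k A]

/-- Comultiplication is multiplicative and the tensor filtration is compatible with products, so the
bound passes from generators to words. -/
theorem comul_mem_tensorWordFiltration
    (hg : ∀ i, Coalgebra.comul (R := k) (g i) ∈ tensorWordFiltration k g d (d i))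
    {n : ℕ} {x : A} (hx : x ∈ wordFiltration k g d n) :
    Coalgebra.comul (R := k) x ∈ tensorWordFiltration k g d n := by
  have hword (w : List ι) : Coalgebra.comul (R := k) (w.map g).prod ∈
      tensorWordFiltration k g d (w.map d).sum := by
    induction w with
    | nil =>
      simp only [List.map_nil, List.prod_nil, List.sum_nil, Bialgebra.comul_one,
        Algebra.TensorProduct.one_def]
      exact tmul_mem_tensorWordFiltration g d (zero_add 0).le (one_mem_wordFiltration g d 0)
        (one_mem_wordFiltration g d 0)
    | cons i w ih =>
      simp only [List.map_cons, List.prod_cons, List.sum_cons, Bialgebra.comul_mul]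
      exact mul_mem_tensorWordFiltration g d (hg i) ih
  suffices h : wordFiltration k g d n ≤
      (tensorWordFiltration k g d n).comap Coalgebra.comul from h hx
  refine Submodule.span_le.mpr ?_
  rintro _ ⟨w, hw, rfl⟩
  exact tensorWordFiltration_mono g d hw (hword w)

/-- If the comultiplication respects the filtration by word degree in a generating family, then
every group-like element is in degree `0`. -/
theorem IsGroupLikeElem.mem_wordFiltration_zero {A : Type*} [Ring A] [Bialgebra k A] (g : ι → A)
    (hg : ∀ i, Coalgebra.comul (R := k) (g i) ∈ tensorWordFiltration k g d (d i))
    (hgen : Algebra.adjoin k (Set.range g) = ⊤) {x : A} (hx : IsGroupLikeElem k x) :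
    x ∈ wordFiltration k g d 0 := by
  classical
  have hex : ∃ n, x ∈ wordFiltration k g d n :=
    mem_wordFiltration_of_mem_adjoin g d (hgen ▸ Algebra.mem_top)
  have hmem := Nat.find_spec hex
  rcases hn : Nat.find hex with _ | m
  · rwa [hn] at hmem
  rw [hn] at hmem
  -- By minimality `x` is not in degree `m`, so a linear functional separates it from that subspace.
  obtain ⟨f, hfx, hf⟩ :=
    Submodule.exists_le_ker_of_notMem (Nat.find_min hex (by omega : m < Nat.find hex))
  have hker : tensorWordFiltration k g d (m + 1) ≤
      LinearMap.ker (LinearMap.mul' k k ∘ₗ TensorProduct.map f f) := by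
    refine Submodule.span_le.mpr ?_
    rintro _ ⟨i, j, hij, a, ha, b, hb, rfl⟩
    simp only [SetLike.mem_coe, LinearMap.mem_ker, LinearMap.comp_apply, TensorProduct.map_tmul,
      LinearMap.mul'_apply, mul_eq_zero]
    -- From `i + j ≤ m + 1`, either `i ≤ m` or `j = 0 ≤ m`, so `f` kills one of the two factors.
    rcases le_or_gt i m with hi | hi
    · exact Or.inl (hf (wordFiltration_mono g d hi ha))
    · exact Or.inr (hf (wordFiltration_mono g d (by omega) hb))
  have h := hker (comul_mem_tensorWordFiltration g d hg hmem)
  rw [hx.comul_eq_tmul_self] at h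
  simp only [LinearMap.mem_ker, LinearMap.comp_apply, TensorProduct.map_tmul,
    LinearMap.mul'_apply, mul_self_eq_zero] at h
  exact absurd h hfx

end Bialgebra

end WordFiltration

/-- A group-like element in the span of a set of group-like elements belongs to that set. -/
theorem IsGroupLikeElem.mem_of_mem_span {k A : Type*} [Field k] [AddCommGroup A] [Module k A]
    [Coalgebra k A] {s : Set A} (hs : ∀ y ∈ s, IsGroupLikeElem k y) {x : A}
    (hx : IsGroupLikeElem k x) (hmem : x ∈ Submodule.span k s) : x ∈ s := by
  by_contra hxs
  -- The set of all group-like elements is linearly independent, and `insert x s` lies inside it.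
  have hli : LinearIndepOn k id (insert x s) :=
    (linearIndepOn_isGroupLikeElem (R := k) (A := A)).mono
      (Set.insert_subset hx fun y hy => hs y hy)
  exact hli.notMem_span_of_insert hxs (by simpa using hmem)

/-! ### The group-like elements of `VSl q` -/

namespace VSl

variable {k : Type*} [Field k] (q : kˣ)

/-- The degree of a generator: `E` and `F` have degree `1`, `K` and `K̄` have degree `0`. -/
def genDegree : VSlGen → ℕ
  | .E => 1
  | .F => 1
  | .K => 0
  | .Kbar => 0

theorem adjoin_range_gen : Algebra.adjoin k (Set.range (gen q)) = ⊤ := by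
  have hrange : Set.range (gen q) = mk q '' Set.range (FreeAlgebra.ι k) := by
    rw [← Set.range_comp]
    rfl
  have hsurj : Function.Surjective (mk q) := RingQuot.mkAlgHom_surjective k (Rel q)
  rw [hrange, Algebra.adjoin_image, FreeAlgebra.adjoin_range_ι, Algebra.map_top,
    AlgHom.range_eq_top]
  exact hsurj

theorem E_mem_wordFiltration : E q ∈ wordFiltration k (gen q) genDegree 1 :=
  gen_mem_wordFiltration (gen q) genDegree VSlGen.E

theorem F_mem_wordFiltration : F q ∈ wordFiltration k (gen q) genDegree 1 :=
  gen_mem_wordFiltration (gen q) genDegree VSlGen.F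

theorem K_mem_wordFiltration : K q ∈ wordFiltration k (gen q) genDegree 0 :=
  gen_mem_wordFiltration (gen q) genDegree VSlGen.K

theorem Kbar_mem_wordFiltration : Kbar q ∈ wordFiltration k (gen q) genDegree 0 :=
  gen_mem_wordFiltration (gen q) genDegree VSlGen.Kbar

theorem J_mem_wordFiltration : J q ∈ wordFiltration k (gen q) genDegree 0 := by
  rw [← K_mul_Kbar, ← add_zero 0]
  exact mul_mem_wordFiltration _ _ (K_mem_wordFiltration q) (Kbar_mem_wordFiltration q)

theorem comulHom_E_mem : comulHom q (E q) ∈ tensorWordFiltration k (gen q) genDegree 1 := by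
  rw [comulHom_E]
  exact add_mem
    (tmul_mem_tensorWordFiltration (gen q) genDegree (zero_add 1).le
      (J_mem_wordFiltration q) (E_mem_wordFiltration q))
    (tmul_mem_tensorWordFiltration (gen q) genDegree (add_zero 1).le
      (E_mem_wordFiltration q) (K_mem_wordFiltration q))

theorem comulHom_F_mem : comulHom q (F q) ∈ tensorWordFiltration k (gen q) genDegree 1 := by
  rw [comulHom_F]
  exact add_mem
    (tmul_mem_tensorWordFiltration (gen q) genDegree (add_zero 1).le
      (F_mem_wordFiltration q) (J_mem_wordFiltration q))
    (tmul_mem_tensorWordFiltration (gen q) genDegree (zero_add 1).le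
      (Kbar_mem_wordFiltration q) (F_mem_wordFiltration q))

theorem comulHom_K_mem : comulHom q (K q) ∈ tensorWordFiltration k (gen q) genDegree 0 := by
  rw [comulHom_K]
  exact tmul_mem_tensorWordFiltration (gen q) genDegree (zero_add 0).le
    (K_mem_wordFiltration q) (K_mem_wordFiltration q)

theorem comulHom_Kbar_mem :
    comulHom q (Kbar q) ∈ tensorWordFiltration k (gen q) genDegree 0 := by
  rw [comulHom_Kbar]
  exact tmul_mem_tensorWordFiltration (gen q) genDegree (zero_add 0).le
    (Kbar_mem_wordFiltration q) (Kbar_mem_wordFiltration q)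

theorem comul_gen_mem (g : VSlGen) :
    Coalgebra.comul (R := k) (gen q g) ∈
      tensorWordFiltration k (gen q) genDegree (genDegree g) := by
  cases g
  exacts [comulHom_E_mem q, comulHom_F_mem q, comulHom_K_mem q, comulHom_Kbar_mem q]

theorem isGroupLikeElem_K : IsGroupLikeElem k (K q) := ⟨counitHom_K q, comulHom_K q⟩

theorem isGroupLikeElem_Kbar : IsGroupLikeElem k (Kbar q) := ⟨counitHom_Kbar q, comulHom_Kbar q⟩

theorem isGroupLikeElem_K_pow_mul_Kbar_pow (i j : ℕ) :
    IsGroupLikeElem k (K q ^ i * Kbar q ^ j) :=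
  (isGroupLikeElem_K q).pow.mul (isGroupLikeElem_Kbar q).pow

theorem commute_K_Kbar : Commute (K q) (Kbar q) := (Kbar_mul_K q).symm

/-- A word of degree 0 involves only `K` and `Kbar`, which commute and can be sorted. -/
theorem wordFiltration_zero_le :
    wordFiltration k (gen q) genDegree 0 ≤
      Submodule.span k {x : VSl q | ∃ i j : ℕ, x = K q ^ i * Kbar q ^ j} := by
  refine Submodule.span_mono ?_
  rintro _ ⟨w, hw, rfl⟩
  induction w with
  | nil => exact ⟨0, 0, by simp⟩
  | cons g w ih =>
    simp only [List.map_cons, List.sum_cons, nonpos_iff_eq_zero, add_eq_zero] at hw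
    obtain ⟨i, j, hij⟩ := ih hw.2.le
    rw [List.map_cons, List.prod_cons, hij]
    cases g with
    | E => exact absurd hw.1 one_ne_zero
    | F => exact absurd hw.1 one_ne_zero
    | K => exact ⟨i + 1, j, by rw [pow_succ', mul_assoc]; rfl⟩
    | Kbar =>
      refine ⟨i, j + 1, ?_⟩
      change Kbar q * _ = _
      rw [← mul_assoc, ((commute_K_Kbar q).symm.pow_right i).eq, mul_assoc, ← pow_succ']

theorem isGroupLikeElem_iff (x : VSl q) :
    IsGroupLikeElem k x ↔ ∃ i j : ℕ, x = K q ^ i * Kbar q ^ j := by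
  constructor
  · intro hx
    have hmem := wordFiltration_zero_le q
      (hx.mem_wordFiltration_zero _ _ (comul_gen_mem q) (adjoin_range_gen q))
    refine hx.mem_of_mem_span ?_ hmem
    rintro _ ⟨i, j, rfl⟩
    exact isGroupLikeElem_K_pow_mul_Kbar_pow q i j
  · rintro ⟨i, j, rfl⟩
    exact isGroupLikeElem_K_pow_mul_Kbar_pow q i j

/-- Swapping the exponents gives a generalized inverse, since `Kbar` is one for `K` and conversely.
-/
theorem K_pow_mul_Kbar_pow_regular (i j : ℕ) :
    K q ^ i * Kbar q ^ j * (K q ^ j * Kbar q ^ i) * (K q ^ i * Kbar q ^ j)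
      = K q ^ i * Kbar q ^ j := by
  have h (m n : ℕ) : Kbar q ^ m * K q ^ n = K q ^ n * Kbar q ^ m :=
    ((commute_K_Kbar q).pow_pow n m).symm.eq
  have hK : K q ^ i * Kbar q ^ i * K q ^ i = K q ^ i := by
    rw [← (commute_K_Kbar q).mul_pow, K_mul_Kbar,
      ← Commute.mul_pow ((J_mul_K q).trans (K_mul_J q).symm), J_mul_K]
  have hKbar : Kbar q ^ j * K q ^ j * Kbar q ^ j = Kbar q ^ j := by
    rw [← (commute_K_Kbar q).symm.mul_pow, Kbar_mul_K,
      ← Commute.mul_pow ((J_mul_Kbar q).trans (Kbar_mul_J q).symm), J_mul_Kbar]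
  calc
    _ = K q ^ i * ((Kbar q ^ j * K q ^ j) * (Kbar q ^ i * K q ^ i)) * Kbar q ^ j := by
      simp only [mul_assoc]
    -- Both inner factors are powers of `Kbar * K`, hence they commute.
    _ = K q ^ i * ((Kbar q ^ i * K q ^ i) * (Kbar q ^ j * K q ^ j)) * Kbar q ^ j := by
      rw [← (commute_K_Kbar q).symm.mul_pow, ← (commute_K_Kbar q).symm.mul_pow,
        (Commute.pow_pow_self _ j i).eq]
    _ = (K q ^ i * Kbar q ^ i * K q ^ i) * (Kbar q ^ j * K q ^ j * Kbar q ^ j) := by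
      simp only [mul_assoc]
    _ = _ := by rw [hK, hKbar]

end VSl

theorem mainTheorem7 {k : Type*} [Field k] (q : kˣ) (hq_one : (q : k) ≠ 1)
    (hq_neg_one : (q : k) ≠ -1) :
    {x : VSl q | IsGroupLikeElem k x} =
        {x : VSl q | ∃ i j : ℕ, x = VSl.K q ^ i * VSl.Kbar q ^ j} ∧
      IsRegularMonoid (groupLikeSubmonoid k (VSl q)) := by
  refine ⟨Set.ext (VSl.isGroupLikeElem_iff q), ?_⟩
  -- The unit and closure under products are part of `groupLikeSubmonoid`; only regularity remains.
  rintro ⟨x, hx⟩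
  obtain ⟨i, j, rfl⟩ := (VSl.isGroupLikeElem_iff q x).mp hx
  exact ⟨⟨_, VSl.isGroupLikeElem_K_pow_mul_Kbar_pow q j i⟩,
    Subtype.ext (VSl.K_pow_mul_Kbar_pow_regular q i j)⟩
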